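/- Consider the two-state quantum walk on $\mathbb{Z}$ with time evolution $U=SC$ on $\mathcal{H}=\ell^2(\mathbb{Z};\mathbb{C}^2)$, where, writing $\Psi(x)={}^T[\Psi_L(x)\ \Psi_R(x)]$, $$(S\Psi)(x)=\begin{bmatrix}\Psi_L(x+1)\\ \Psi_R(x-1)\end{bmatrix},\qquad (C\Psi)(x)=e^{i\Delta_x}\begin{bmatrix}\alpha_x&\beta_x\\-\overline{\beta_x}&\overline{\alpha_x}\end{bmatrix}\Psi(x).$$ Let $\alpha,\beta\in\mathbb{C}$ with $\alpha\neq0$, $\beta\neq 0$, $|\alpha|^2+|\beta|^2=1$, and let $\Delta,\Delta_o\in\mathbb{R}$. Suppose that $(\alpha_x,\beta_x,\Delta_x)=(\alpha,\beta,\Delta)$ for all $x\neq0$ and $(\alpha_0,\beta_0,\Delta_0)=(\alpha,\beta,\Delta_o)$ at $x=0$. Let $\sigma_{\rm p}(U)$ be the set of eigenvalues of $U$. Consider - Condition 1: $|\beta|\cos(\Delta_o-\Delta)-|\alpha|\sin(\Delta_o-\Delta)<|\beta|$; - Condition 2: $|\beta|\cos(\Delta_o-\Delta)+|\alpha|\sin(\Delta_o-\Delta)<|\beta|$;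 and put $$z_1=\frac{|\beta|(|\beta|+i|\alpha|)e^{i\Delta_o}-e^{i\Delta}}{\bigl||\beta|(|\beta|+i|\alpha|)e^{i\Delta_o}-e^{i\Delta}\bigr|},\quad z_2=-z_1,\qquad z_3=\frac{|\beta|(|\beta|-i|\alpha|)e^{i\Delta_o}-e^{i\Delta}}{\bigl||\beta|(|\beta|-i|\alpha|)e^{i\Delta_o}-e^{i\Delta}\bigr|},\quad z_4=-z_3.$$ Then: 1. $\sigma_{\rm p}(U)\neq\emptyset$ if and only if Condition 1 or Condition 2 holds. 2. If Condition 1 holds, then $z_1,z_2\in\sigma_{\rm p}(U)$. If Condition 2 holds, then $z_3,z_4\in\sigma_{\rm p}(U)$. 3. There are no other eigenvalues: every $z\in\sigma_{\rm p}(U)$ satisfies $z\in\{z_1,z_2\}$ with Condition 1 holding, or $z\in\{z_3,z_4\}$ with Condition 2 holding. 4. If both conditions hold, then $\sigma_{\rm p}(U)=\{z_1,z_2,z_3,z_4\}$ and these four eigenvalues are distinct. -/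

import Mathlib

/-- The Hilbert space `ℓ²(ℤ; ℂ²)` of states. For `Ψ : QWState`, `Ψ x 0` is the left component
`Ψ_L(x)` and `Ψ x 1` is the right component `Ψ_R(x)`. -/
abbrev QWState : Type := lp (fun _ : ℤ => EuclideanSpace ℂ (Fin 2)) 2

theorem memlp_two_iff (f : ∀ _ : ℤ, EuclideanSpace ℂ (Fin 2)) :
    Memℓp f 2 ↔ Summable fun x => ‖f x 0‖ ^ 2 + ‖f x 1‖ ^ 2 := by
  rw [memℓp_gen_iff (by norm_num)]
  have h : ∀ x, ‖f x‖ ^ (2 : ENNReal).toReal = ‖f x 0‖ ^ 2 + ‖f x 1‖ ^ 2 := fun x => by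
    have h2 : (2 : ENNReal).toReal = ((2 : ℕ) : ℝ) := by norm_num
    rw [h2, Real.rpow_natCast, EuclideanSpace.norm_sq_eq, Fin.sum_univ_two]
  simp only [h]

/-- Parameters `(α, β, Δ)` of a coin matrix. -/
structure CoinParam where
  α : ℂ
  β : ℂ
  Δ : ℝ
  α_ne_zero : α ≠ 0
  norm_sq_add : ‖α‖ ^ 2 + ‖β‖ ^ 2 = 1

/-- The coin matrix `e^{iΔ} [α, β; -β̄, ᾱ]`. -/
noncomputable def CoinParam.coinMatrix (c : CoinParam) : Matrix (Fin 2) (Fin 2) ℂ :=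
  Complex.exp (Complex.I * c.Δ) • !![c.α, c.β; -(starRingEnd ℂ c.β), starRingEnd ℂ c.α]

theorem CoinParam.norm_sq_mulVec (c : CoinParam) (v : Fin 2 → ℂ) :
    ‖(c.coinMatrix.mulVec v) 0‖ ^ 2 + ‖(c.coinMatrix.mulVec v) 1‖ ^ 2
      = ‖v 0‖ ^ 2 + ‖v 1‖ ^ 2 := by
  have h := c.norm_sq_add
  have he : ‖Complex.exp (Complex.I * c.Δ)‖ = 1 := by
    rw [mul_comm]; exact Complex.norm_exp_ofReal_mul_I _
  have h0 : (c.coinMatrix.mulVec v) 0 =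
      Complex.exp (Complex.I * c.Δ) * (c.α * v 0 + c.β * v 1) := by
    simp [CoinParam.coinMatrix, Matrix.mulVec, dotProduct, Fin.sum_univ_two]; ring
  have h1 : (c.coinMatrix.mulVec v) 1 =
      Complex.exp (Complex.I * c.Δ) * (-(starRingEnd ℂ c.β) * v 0 + starRingEnd ℂ c.α * v 1) := by
    simp [CoinParam.coinMatrix, Matrix.mulVec, dotProduct, Fin.sum_univ_two]; ring
  rw [h0, h1, norm_mul, norm_mul, he, one_mul, one_mul]
  simp only [← Complex.normSq_eq_norm_sq, Complex.normSq_apply, Complex.add_re, Complex.add_im,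
    Complex.mul_re, Complex.mul_im, Complex.neg_re, Complex.neg_im, Complex.conj_re,
    Complex.conj_im] at h ⊢
  linear_combination ((v 0).re ^ 2 + (v 0).im ^ 2 + (v 1).re ^ 2 + (v 1).im ^ 2) * h

/-- The shift operator `(SΨ)(x) = (Ψ_L(x+1), Ψ_R(x-1))` on `ℓ²(ℤ; ℂ²)`. -/
noncomputable def shiftOp : QWState →ₗ[ℂ] QWState where
  toFun Ψ := ⟨fun x => !₂[Ψ (x + 1) 0, Ψ (x - 1) 1], by
    have h := (memlp_two_iff _).1 (lp.memℓp Ψ)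
    have h0 : Summable fun x : ℤ => ‖Ψ x 0‖ ^ 2 :=
      h.of_nonneg_of_le (fun _ => by positivity) fun _ => le_add_of_nonneg_right (by positivity)
    have h1 : Summable fun x : ℤ => ‖Ψ x 1‖ ^ 2 :=
      h.of_nonneg_of_le (fun _ => by positivity) fun _ => le_add_of_nonneg_left (by positivity)
    exact (memlp_two_iff _).2
      (((Equiv.addRight (1 : ℤ)).summable_iff.2 h0).add
        ((Equiv.subRight (1 : ℤ)).summable_iff.2 h1))⟩
  map_add' Φ Ψ := by ext x i; fin_cases i <;> rfl
  map_smul' z Ψ := by ext x i; fin_cases i <;> rfl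

/-- The coin operator `(CΨ)(x) = C̃_x Ψ(x)` on `ℓ²(ℤ; ℂ²)`. -/
noncomputable def coinOp (c : ℤ → CoinParam) : QWState →ₗ[ℂ] QWState where
  toFun Ψ := ⟨fun x => WithLp.toLp 2 ((c x).coinMatrix.mulVec (Ψ x).ofLp), by
    have h := (memlp_two_iff _).1 (lp.memℓp Ψ)
    refine (memlp_two_iff _).2 (h.congr fun x => ?_)
    exact ((c x).norm_sq_mulVec (Ψ x).ofLp).symm⟩
  map_add' Φ Ψ := by
    ext x i
    exact congrFun (Matrix.mulVec_add (c x).coinMatrix (Φ x).ofLp (Ψ x).ofLp) i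
  map_smul' z Ψ := by
    ext x i
    exact congrFun (Matrix.mulVec_smul (c x).coinMatrix z (Ψ x).ofLp) i

/-- The time evolution `U = SC`. -/
noncomputable def evolution (c : ℤ → CoinParam) : QWState →ₗ[ℂ] QWState :=
  shiftOp ∘ₗ coinOp c

/-- Two-phase quantum walk with one defect: parameters `m` on the negative part, `o` at the
origin, `p` on the positive part. -/
noncomputable def twoPhaseOneDefect (m o p : CoinParam) (x : ℤ) : CoinParam :=
  if x < 0 then m else if x = 0 then o else p

/-- The point spectrum `σ_p(U)`, i.e. the set of eigenvalues of `U` on `ℓ²(ℤ; ℂ²)`. -/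
def pointSpectrum (U : QWState →ₗ[ℂ] QWState) : Set ℂ :=
  {z | Module.End.HasEigenvalue U z}

/-- `|β|(|β| + i s|α|)e^{iΔ_o} - e^{iΔ}` divided by its modulus, for a sign `s = ±1`. -/
noncomputable def defectEigenvalue (α β : ℂ) (Δ Δo s : ℝ) : ℂ :=
  let w : ℂ := (‖β‖ : ℂ) * ((‖β‖ : ℂ) + Complex.I * (s : ℂ) * (‖α‖ : ℂ)) *
    Complex.exp (Complex.I * Δo) - Complex.exp (Complex.I * Δ)
  w / (‖w‖ : ℂ)

/-- `|β| cos(Δ_o - Δ) - |α| sin(Δ_o - Δ) < |β|`. -/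
def Condition1 (α β : ℂ) (Δ Δo : ℝ) : Prop :=
  ‖β‖ * Real.cos (Δo - Δ) - ‖α‖ * Real.sin (Δo - Δ) < ‖β‖

/-- `|β| cos(Δ_o - Δ) + |α| sin(Δ_o - Δ) < |β|`. -/
def Condition2 (α β : ℂ) (Δ Δo : ℝ) : Prop :=
  ‖β‖ * Real.cos (Δo - Δ) + ‖α‖ * Real.sin (Δo - Δ) < ‖β‖

/-!
With `u(x) = (Ψ_L(x-1), Ψ_R(x))` the equation `UΨ = zΨ` becomes the recursion
`α u(x+1) = M_x u(x)`, where `M_x = [ω, -β; -β̄, ω̄]` and `ω = z e^{-iΔ_x}`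
(`mem_pointSpectrum_evolution_iff`); here `|z| = 1` because `U` is an isometry. Write `a = |α|` and
`b = |β|`.

Since `M / α` has determinant of modulus one, the Wronskian of a solution and its translate has
constant modulus on a half-line without the defect. A square-summable solution therefore has
Wronskian zero, which means that its values there are eigenvectors of `M`, for a real root `l` of
`l² - 2 Re(ω) l + a²` with `|l| < a` (`exists_real_eigenvalue_of_tendsto_zero`). The half-line to the
left has the same form after inverting `M` (`TransferStep.reverse`). The roots have product `a²`,
so both half-lines share the same `l`, and an eigenvector exists exactly when `M_0` maps the line of
the left solution to the line of the right one. This is the matching condition `V + V̄ = -2b²` for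
`V = (ω - l) z e^{-iΔ_o}` (`matching_iff`).

As `|V| = b`, it says `V = -b(b ± ia)`. Multiplied by `e^{iΔ_o}`, this reads `w = m z`, where
`w = b(b ± ia)e^{iΔ_o} - e^{iΔ}` and `m = -a² / l` is real with `|m| > a`
(`exists_matching_iff`). So `z = ± w / |w|`, and the requirement `|w| > a` is the first or the second
condition, depending on the sign (`norm_lt_norm_defectNumerator_iff`).

The two values of `w` are real multiples of each other only if `cos(Δ_o - Δ) = b²`, which the two
conditions together exclude (`defectNumerator_cross_ne_zero`); so the four eigenvalues are distinct.
-/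

/-! ### The eigenvalue equation as a transfer recursion -/

theorem evolution_apply_zero (c : ℤ → CoinParam) (Ψ : QWState) (x : ℤ) :
    evolution c Ψ x 0 = Complex.exp (Complex.I * (c (x + 1)).Δ) *
      ((c (x + 1)).α * Ψ (x + 1) 0 + (c (x + 1)).β * Ψ (x + 1) 1) := by
  have h : evolution c Ψ x 0 = ((c (x + 1)).coinMatrix.mulVec (Ψ (x + 1)).ofLp) 0 := rfl
  rw [h]
  simp [CoinParam.coinMatrix, Matrix.mulVec, dotProduct, Fin.sum_univ_two]
  ring

theorem evolution_apply_one (c : ℤ → CoinParam) (Ψ : QWState) (x : ℤ) :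
    evolution c Ψ x 1 = Complex.exp (Complex.I * (c (x - 1)).Δ) *
      (-(starRingEnd ℂ (c (x - 1)).β) * Ψ (x - 1) 0 +
        starRingEnd ℂ (c (x - 1)).α * Ψ (x - 1) 1) := by
  have h : evolution c Ψ x 1 = ((c (x - 1)).coinMatrix.mulVec (Ψ (x - 1)).ofLp) 1 := rfl
  rw [h]
  simp [CoinParam.coinMatrix, Matrix.mulVec, dotProduct, Fin.sum_univ_two]
  ring

theorem summable_norm_sq_component (Ψ : QWState) (i : Fin 2) :
    Summable fun x : ℤ => ‖Ψ x i‖ ^ 2 := by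
  have h := (memlp_two_iff _).1 (lp.memℓp Ψ)
  fin_cases i
  · exact h.of_nonneg_of_le (fun _ => by positivity)
      fun _ => le_add_of_nonneg_right (by positivity)
  · exact h.of_nonneg_of_le (fun _ => by positivity)
      fun _ => le_add_of_nonneg_left (by positivity)

theorem norm_sq_eq_tsum (Ψ : QWState) :
    ‖Ψ‖ ^ 2 = ∑' x : ℤ, (‖Ψ x 0‖ ^ 2 + ‖Ψ x 1‖ ^ 2) := by
  have h := lp.norm_rpow_eq_tsum (p := 2) (by norm_num) Ψ
  have h2 : (2 : ENNReal).toReal = ((2 : ℕ) : ℝ) := by norm_num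
  simp only [h2, Real.rpow_natCast] at h
  simpa only [EuclideanSpace.norm_sq_eq, Fin.sum_univ_two] using h

theorem tsum_add_translates {f g : ℤ → ℝ} (hf : Summable f) (hg : Summable g) :
    ∑' x, (f (x + 1) + g (x - 1)) = ∑' x, (f x + g x) := by
  have hf' : Summable fun x => f (x + 1) := (Equiv.addRight (1 : ℤ)).summable_iff.2 hf
  have hg' : Summable fun x => g (x - 1) := (Equiv.subRight (1 : ℤ)).summable_iff.2 hg
  rw [hf'.tsum_add hg', hf.tsum_add hg]
  exact congrArg₂ (· + ·) ((Equiv.addRight (1 : ℤ)).tsum_eq f)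
    ((Equiv.subRight (1 : ℤ)).tsum_eq g)

theorem norm_sq_shiftOp (Ψ : QWState) : ‖shiftOp Ψ‖ ^ 2 = ‖Ψ‖ ^ 2 := by
  rw [norm_sq_eq_tsum (shiftOp Ψ), norm_sq_eq_tsum Ψ]
  exact tsum_add_translates (summable_norm_sq_component Ψ 0) (summable_norm_sq_component Ψ 1)

theorem norm_sq_coinOp (c : ℤ → CoinParam) (Ψ : QWState) : ‖coinOp c Ψ‖ ^ 2 = ‖Ψ‖ ^ 2 := by
  rw [norm_sq_eq_tsum (coinOp c Ψ), norm_sq_eq_tsum Ψ]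
  exact tsum_congr fun x => (c x).norm_sq_mulVec (Ψ x).ofLp

/-- The time evolution is an isometry, so its eigenvalues have modulus one. -/
theorem norm_eq_one_of_evolution_eq_smul {c : ℤ → CoinParam} {Ψ : QWState} {z : ℂ}
    (h : evolution c Ψ = z • Ψ) (hΨ : Ψ ≠ 0) : ‖z‖ = 1 := by
  have h1 : ‖evolution c Ψ‖ ^ 2 = ‖Ψ‖ ^ 2 :=
    (norm_sq_shiftOp (coinOp c Ψ)).trans (norm_sq_coinOp c Ψ)
  rw [h, norm_smul, mul_pow] at h1
  have h2 : ‖z‖ ^ 2 = 1 :=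
    mul_right_cancel₀ (pow_ne_zero 2 (norm_ne_zero_iff.2 hΨ)) (h1.trans (one_mul _).symm)
  exact (pow_eq_one_iff_of_nonneg (norm_nonneg z) two_ne_zero).1 h2

/-- The pair `(p', q')` is the image of `(p, q)` under the transfer matrix
`α⁻¹ [ω, -β; -β̄, ω̄]`. -/
def TransferStep (α β ω p q p' q' : ℂ) : Prop :=
  α * p' = ω * p - β * q ∧ α * q' = -(starRingEnd ℂ β) * p + starRingEnd ℂ ω * q

theorem mul_conj_eq_one {z : ℂ} (hz : ‖z‖ = 1) : z * starRingEnd ℂ z = 1 := by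
  rw [Complex.mul_conj, Complex.normSq_eq_norm_sq, hz]; simp

theorem mul_conj_eq_norm_sq (z : ℂ) : z * starRingEnd ℂ z = (‖z‖ : ℂ) ^ 2 := by
  rw [Complex.mul_conj, Complex.normSq_eq_norm_sq]; simp

theorem norm_exp_I_mul (t : ℝ) : ‖Complex.exp (Complex.I * t)‖ = 1 := by
  rw [mul_comm]; exact Complex.norm_exp_ofReal_mul_I t

/-- One site of the eigenvalue equation, solved for the values on the right of the site. -/
theorem transferStep_iff {α β z e p q p' q' : ℂ} (hα : α ≠ 0) (hαβ : ‖α‖ ^ 2 + ‖β‖ ^ 2 = 1)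
    (hz : ‖z‖ = 1) (he : ‖e‖ = 1) :
    TransferStep α β (z * starRingEnd ℂ e) p q p' q' ↔
      e * (α * p' + β * q) = z * p ∧
        e * (-(starRingEnd ℂ β) * p' + starRingEnd ℂ α * q) = z * q' := by
  have hzz := mul_conj_eq_one hz
  have hee := mul_conj_eq_one he
  have hab : α * starRingEnd ℂ α + β * starRingEnd ℂ β = 1 := by
    rw [mul_conj_eq_norm_sq, mul_conj_eq_norm_sq]; exact_mod_cast hαβ
  have he0 : e ≠ 0 := left_ne_zero_of_mul_eq_one hee
  have hz0 : z ≠ 0 := left_ne_zero_of_mul_eq_one hzz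
  simp only [TransferStep, map_mul, Complex.conj_conj]
  set a' := starRingEnd ℂ α
  set b' := starRingEnd ℂ β
  set z' := starRingEnd ℂ z
  set e' := starRingEnd ℂ e
  constructor
  · rintro ⟨h1, h2⟩
    refine ⟨by linear_combination e * h1 + z * p * hee, ?_⟩
    apply mul_left_cancel₀ hα
    linear_combination -e * b' * h1 - z * h2 + e * q * hab - z * b' * p * hee - e * q * hzz
  · rintro ⟨h1, h2⟩
    have h3 : α * p' = z * e' * p - β * q := by
      apply mul_left_cancel₀ he0
      linear_combination h1 - z * p * hee
    refine ⟨h3, ?_⟩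
    apply mul_left_cancel₀ hz0
    linear_combination -α * h2 - e * b' * h3 + e * q * hab - z * b' * p * hee - e * q * hzz

/-- The eigenvalue equation `UΨ = zΨ` is the transfer recursion for the pairs
`(Ψ_L(x-1), Ψ_R(x))`. -/
theorem evolution_eq_smul_iff (c : ℤ → CoinParam) (Ψ : QWState) {z : ℂ} (hz : ‖z‖ = 1) :
    evolution c Ψ = z • Ψ ↔ ∀ x : ℤ, TransferStep (c x).α (c x).β
      (z * starRingEnd ℂ (Complex.exp (Complex.I * (c x).Δ)))
      (Ψ (x - 1) 0) (Ψ x 1) (Ψ x 0) (Ψ (x + 1) 1) := by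
  simp only [fun x => transferStep_iff (p := Ψ (x - 1) 0) (q := Ψ x 1) (p' := Ψ x 0)
    (q' := Ψ (x + 1) 1) (c x).α_ne_zero (c x).norm_sq_add hz (norm_exp_I_mul (c x).Δ)]
  constructor
  · intro h x
    have h0 : evolution c Ψ (x - 1) 0 = z * Ψ (x - 1) 0 := by rw [h]; rfl
    have h1 : evolution c Ψ (x + 1) 1 = z * Ψ (x + 1) 1 := by rw [h]; rfl
    rw [evolution_apply_zero, sub_add_cancel] at h0
    rw [evolution_apply_one, add_sub_cancel_right] at h1
    exact ⟨h0, h1⟩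
  · intro h
    ext x i
    have hs : (z • Ψ) x i = z * Ψ x i := rfl
    rw [hs]
    fin_cases i
    · have := (h (x + 1)).1
      rw [add_sub_cancel_right] at this
      exact (evolution_apply_zero c Ψ x).trans this
    · have := (h (x - 1)).2
      rw [sub_add_cancel] at this
      exact (evolution_apply_one c Ψ x).trans this

/-- Eigenvalues in terms of square-summable solutions `(p x, q x) = (Ψ_L(x-1), Ψ_R(x))` of the
transfer recursion. -/
theorem mem_pointSpectrum_evolution_iff (c : ℤ → CoinParam) (z : ℂ) :
    z ∈ pointSpectrum (evolution c) ↔ ‖z‖ = 1 ∧ ∃ p q : ℤ → ℂ,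
      (Summable fun x => ‖p x‖ ^ 2) ∧ (Summable fun x => ‖q x‖ ^ 2) ∧
      (∃ x, ¬(p x = 0 ∧ q x = 0)) ∧ ∀ x, TransferStep (c x).α (c x).β
        (z * starRingEnd ℂ (Complex.exp (Complex.I * (c x).Δ)))
        (p x) (q x) (p (x + 1)) (q (x + 1)) := by
  constructor
  · intro hz
    obtain ⟨Ψ, hΨ⟩ := Module.End.HasEigenvalue.exists_hasEigenvector hz
    have hU := hΨ.apply_eq_smul
    have hz1 := norm_eq_one_of_evolution_eq_smul hU hΨ.2
    refine ⟨hz1, fun x => Ψ (x - 1) 0, fun x => Ψ x 1,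
      (Equiv.subRight (1 : ℤ)).summable_iff.2 (summable_norm_sq_component Ψ 0),
      summable_norm_sq_component Ψ 1, ?_, fun x => ?_⟩
    · by_contra! h
      refine hΨ.2 ?_
      ext x i
      fin_cases i
      · have := (h (x + 1)).1
        rwa [add_sub_cancel_right] at this
      · exact (h x).2
    · have := (evolution_eq_smul_iff c Ψ hz1).1 hU x
      rwa [← add_sub_cancel_right x 1, sub_add_cancel] at this ⊢
  · rintro ⟨hz1, p, q, hp, hq, ⟨x, hx⟩, h⟩
    have hmem : Memℓp (fun x : ℤ => (!₂[p (x + 1), q x] : EuclideanSpace ℂ (Fin 2))) 2 :=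
      (memlp_two_iff _).2 (((Equiv.addRight (1 : ℤ)).summable_iff.2 hp).add hq)
    let Ψ : QWState := ⟨_, hmem⟩
    have h0 : ∀ x, Ψ x 0 = p (x + 1) := fun _ => rfl
    have h1 : ∀ x, Ψ x 1 = q x := fun _ => rfl
    refine Module.End.hasEigenvalue_of_hasEigenvector (x := Ψ)
      ⟨Module.End.mem_eigenspace_iff.2 ((evolution_eq_smul_iff c Ψ hz1).2 fun x => ?_), ?_⟩
    · rw [h0, h0, h1, h1, sub_add_cancel]
      exact h x
    · intro hΨ
      refine hx ⟨?_, ?_⟩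
      · have := h0 (x - 1)
        rw [sub_add_cancel] at this
        rw [← this, hΨ]; rfl
      · rw [← h1, hΨ]; rfl

/-! ### Decaying solutions on a half-line -/

/-- The transfer matrix has a determinant of modulus one. Hence the Wronskian of a solution and its
translate has constant modulus, and for a solution tending to zero it vanishes. -/
theorem wronskian_eq_zero_of_tendsto_zero {α β ω : ℂ} (hα : α ≠ 0)
    (hαβ : ‖α‖ ^ 2 + ‖β‖ ^ 2 = 1) (hω : ‖ω‖ = 1) {p q : ℕ → ℂ}
    (h : ∀ n, TransferStep α β ω (p n) (q n) (p (n + 1)) (q (n + 1)))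
    (hp : Filter.Tendsto p Filter.atTop (nhds 0)) (hq : Filter.Tendsto q Filter.atTop (nhds 0)) :
    p 0 * q 1 - q 0 * p 1 = 0 := by
  have hww := mul_conj_eq_one hω
  have hab : α * starRingEnd ℂ α + β * starRingEnd ℂ β = 1 := by
    rw [mul_conj_eq_norm_sq, mul_conj_eq_norm_sq]; exact_mod_cast hαβ
  set W : ℕ → ℂ := fun n => p n * q (n + 1) - q n * p (n + 1) with hW
  have step : ∀ n, α * W (n + 1) = starRingEnd ℂ α * W n := by
    intro n
    obtain ⟨h1, h2⟩ := h n
    obtain ⟨h3, h4⟩ := h (n + 1)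
    apply mul_left_cancel₀ (pow_ne_zero 2 hα)
    simp only [hW]
    -- `α W` is a quadratic form in `(p, q)` which the matrix `[ω, -β; -β̄, ω̄]` scales by its
    -- determinant `|α|²`.
    have e1 : α * (p (n + 1) * q (n + 2) - q (n + 1) * p (n + 2)) =
        -(starRingEnd ℂ β) * p (n + 1) ^ 2 + (starRingEnd ℂ ω - ω) * (p (n + 1) * q (n + 1))
          + β * q (n + 1) ^ 2 := by
      linear_combination p (n + 1) * h4 - q (n + 1) * h3
    have e0 : α * (p n * q (n + 1) - q n * p (n + 1)) =
        -(starRingEnd ℂ β) * p n ^ 2 + (starRingEnd ℂ ω - ω) * (p n * q n) + β * q n ^ 2 := by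
      linear_combination p n * h2 - q n * h1
    rw [show n + 1 + 1 = n + 2 from rfl, e1]
    have e2 : α ^ 2 * (-(starRingEnd ℂ β) * p (n + 1) ^ 2 +
        (starRingEnd ℂ ω - ω) * (p (n + 1) * q (n + 1)) + β * q (n + 1) ^ 2) =
        -(starRingEnd ℂ β) * (α * p (n + 1)) ^ 2 +
        (starRingEnd ℂ ω - ω) * ((α * p (n + 1)) * (α * q (n + 1)))
          + β * (α * q (n + 1)) ^ 2 := by ring
    have hdet : ω * starRingEnd ℂ ω - β * starRingEnd ℂ β = α * starRingEnd ℂ α := by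
      linear_combination hww - hab
    rw [e2, h1, h2]
    linear_combination (-(starRingEnd ℂ β) * p n ^ 2 + (starRingEnd ℂ ω - ω) * (p n * q n) +
      β * q n ^ 2) * hdet - α * starRingEnd ℂ α * e0
  have hnorm : ∀ n, ‖W n‖ = ‖W 0‖ := by
    intro n
    induction n with
    | zero => rfl
    | succ n ih =>
      have := congrArg norm (step n)
      rw [norm_mul, norm_mul, RCLike.norm_conj] at this
      exact (mul_left_cancel₀ (norm_ne_zero_iff.2 hα) this).trans ih
  have hlim : Filter.Tendsto W Filter.atTop (nhds 0) := by
    have := (hp.mul ((Filter.tendsto_add_atTop_iff_nat 1).2 hq)).sub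
      (hq.mul ((Filter.tendsto_add_atTop_iff_nat 1).2 hp))
    simpa using this
  have h0 := tendsto_zero_iff_norm_tendsto_zero.1 hlim
  simp only [hnorm] at h0
  exact norm_eq_zero.1 (tendsto_nhds_unique tendsto_const_nhds h0)

/-- A nonzero solution on a half-line that tends to zero starts at an eigenvector of
`[ω, -β; -β̄, ω̄]`. Its eigenvalue is real, because a pair of conjugate roots of the characteristic
polynomial has modulus `|α|`, so that the factor `l / α` of a step would have modulus one. -/
theorem exists_real_eigenvalue_of_tendsto_zero {α β ω : ℂ} (hα : α ≠ 0) (hβ : β ≠ 0)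
    (hαβ : ‖α‖ ^ 2 + ‖β‖ ^ 2 = 1) (hω : ‖ω‖ = 1) {p q : ℕ → ℂ}
    (h : ∀ n, TransferStep α β ω (p n) (q n) (p (n + 1)) (q (n + 1)))
    (hp : Filter.Tendsto p Filter.atTop (nhds 0)) (hq : Filter.Tendsto q Filter.atTop (nhds 0))
    (h0 : ¬(p 0 = 0 ∧ q 0 = 0)) :
    ∃ l : ℝ, |l| < ‖α‖ ∧ l ^ 2 - 2 * ω.re * l + ‖α‖ ^ 2 = 0 ∧ p 0 ≠ 0 ∧
      β * q 0 = (ω - l) * p 0 := by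
  have hww := mul_conj_eq_one hω
  have hab : α * starRingEnd ℂ α + β * starRingEnd ℂ β = 1 := by
    rw [mul_conj_eq_norm_sq, mul_conj_eq_norm_sq]; exact_mod_cast hαβ
  have hW := wronskian_eq_zero_of_tendsto_zero hα hαβ hω h hp hq
  obtain ⟨h1, h2⟩ := h 0
  rw [zero_add] at h1 h2
  have hp0 : p 0 ≠ 0 := by
    intro hp0
    have hq0 : q 0 ≠ 0 := fun hq0 => h0 ⟨hp0, hq0⟩
    have hp1 : p 1 = 0 := by simpa [hp0, hq0] using hW
    simp [hp0, hp1, hβ, hq0] at h1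
  obtain ⟨k, hk⟩ : ∃ k, p 1 = k * p 0 := ⟨p 1 / p 0, (div_mul_cancel₀ _ hp0).symm⟩
  have hk' : q 1 = k * q 0 := by
    apply mul_left_cancel₀ hp0
    linear_combination hW + q 0 * hk
  have hpow : ∀ n, p n = k ^ n * p 0 ∧ q n = k ^ n * q 0 := by
    intro n
    induction n with
    | zero => simp
    | succ n ih =>
      obtain ⟨h3, h4⟩ := h n
      rw [ih.1, ih.2] at h3 h4
      constructor <;> apply mul_left_cancel₀ hα
      · linear_combination h3 - k ^ n * h1 + k ^ n * α * hk
      · linear_combination h4 - k ^ n * h2 + k ^ n * α * hk'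
  have hk1 : ‖k‖ < 1 := by
    rw [← tendsto_pow_atTop_nhds_zero_iff_norm_lt_one]
    have := hp.mul_const (p 0)⁻¹
    rw [zero_mul] at this
    refine this.congr fun n => ?_
    rw [(hpow n).1, mul_assoc, mul_inv_cancel₀ hp0, mul_one]
  have hl : ‖α * k‖ < ‖α‖ := by
    rw [norm_mul]
    exact mul_lt_of_lt_one_right (norm_pos_iff.2 hα) hk1
  have hq0 : β * q 0 = (ω - α * k) * p 0 := by
    linear_combination h1 - α * hk
  have hchar : (α * k) ^ 2 - (ω + starRingEnd ℂ ω) * (α * k) + α * starRingEnd ℂ α = 0 := by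
    apply mul_right_cancel₀ hp0
    linear_combination β * α * hk' - β * h2 + (α * k - starRingEnd ℂ ω) * hq0 - p 0 * hww +
      p 0 * hab
  generalize α * k = m at hl hq0 hchar
  rw [mul_conj_eq_norm_sq, Complex.add_conj] at hchar
  have hre := congrArg Complex.re hchar
  have him := congrArg Complex.im hchar
  simp [pow_two] at hre him
  have hm : m.re * m.re + m.im * m.im < ‖α‖ * ‖α‖ := by
    rw [← Complex.normSq_apply, Complex.normSq_eq_norm_sq, ← pow_two]
    gcongr
  have him0 : m.im = 0 := by
    by_contra hne
    have : m.re = ω.re := by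
      apply mul_left_cancel₀ hne
      linarith
    rw [← this] at hre
    nlinarith
  have hmr : ((m.re : ℝ) : ℂ) = m := Complex.ext rfl (by simp [him0])
  refine ⟨m.re, ?_, ?_, hp0, by rw [hmr]; exact hq0⟩
  · rw [← Real.norm_eq_abs, ← Complex.norm_real, hmr]; exact hl
  · rw [him0] at hre
    linarith

/-! ### Square-summable solutions with a defect at the origin -/

/-- The transfer matrix is invertible, and its inverse is the transfer matrix with parameters
`(ᾱ, -β, ω̄)`. -/
theorem TransferStep.reverse {α β ω p q p' q' : ℂ} (hα : α ≠ 0)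
    (hαβ : ‖α‖ ^ 2 + ‖β‖ ^ 2 = 1) (hω : ‖ω‖ = 1) (h : TransferStep α β ω p q p' q') :
    TransferStep (starRingEnd ℂ α) (-β) (starRingEnd ℂ ω) p' q' p q := by
  have hww := mul_conj_eq_one hω
  have hab : α * starRingEnd ℂ α + β * starRingEnd ℂ β = 1 := by
    rw [mul_conj_eq_norm_sq, mul_conj_eq_norm_sq]; exact_mod_cast hαβ
  obtain ⟨h1, h2⟩ := h
  constructor <;> apply mul_left_cancel₀ hα
  · linear_combination -starRingEnd ℂ ω * h1 - β * h2 + p * hab - p * hww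
  · rw [map_neg, Complex.conj_conj]
    linear_combination -starRingEnd ℂ β * h1 - ω * h2 + q * hab - q * hww

theorem TransferStep.eq_zero {α β ω p' q' : ℂ} (hα : α ≠ 0)
    (h : TransferStep α β ω 0 0 p' q') : p' = 0 ∧ q' = 0 := by
  simpa [TransferStep, hα] using h

theorem TransferStep.smul {α β ω p q p' q' : ℂ} (k : ℂ) (h : TransferStep α β ω p q p' q') :
    TransferStep α β ω (k * p) (k * q) (k * p') (k * q') :=
  ⟨by linear_combination k * h.1, by linear_combination k * h.2⟩

/-- A solution vanishing at one site vanishes identically. -/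
theorem eq_zero_of_transferStep {α β : ℂ} {ω p q : ℤ → ℂ} (hα : α ≠ 0)
    (hαβ : ‖α‖ ^ 2 + ‖β‖ ^ 2 = 1) (hω : ∀ x, ‖ω x‖ = 1)
    (h : ∀ x, TransferStep α β (ω x) (p x) (q x) (p (x + 1)) (q (x + 1))) {y : ℤ}
    (h0 : p y = 0 ∧ q y = 0) (x : ℤ) : p x = 0 ∧ q x = 0 := by
  induction x using Int.inductionOn' (b := y) with
  | zero => exact h0
  | succ x _ ih =>
    have := h x
    rw [ih.1, ih.2] at this
    exact this.eq_zero hα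
  | pred x _ ih =>
    have := (h (x - 1)).reverse hα hαβ (hω _)
    rw [sub_add_cancel, ih.1, ih.2] at this
    exact this.eq_zero ((map_ne_zero _).2 hα)

/-- The roots of `l² - 2tl + a²` have product `a²`, so at most one of them is smaller than `a`. -/
theorem eq_of_root_of_abs_lt {a t l₁ l₂ : ℝ} (h₁ : l₁ ^ 2 - 2 * t * l₁ + a ^ 2 = 0)
    (h₂ : l₂ ^ 2 - 2 * t * l₂ + a ^ 2 = 0) (hl₁ : |l₁| < a) (hl₂ : |l₂| < a) : l₁ = l₂ := by
  by_contra hne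
  have hsum : l₁ + l₂ = 2 * t := by
    apply mul_left_cancel₀ (sub_ne_zero.2 hne)
    linear_combination h₁ - h₂
  have hprod : l₁ * l₂ = a ^ 2 := by
    rw [← hsum] at h₁
    linear_combination -h₁
  have := mul_lt_mul'' hl₁ hl₂ (abs_nonneg _) (abs_nonneg _)
  rw [← abs_mul, hprod] at this
  nlinarith [le_abs_self (a ^ 2)]

/-- The defect maps the direction `(β, l - ω̄)`, from which solutions decay at `-∞`, to the direction
`(β, ω - l)`, from which they decay at `+∞`, exactly when the matching condition on the right
holds. -/
theorem matching_iff {α β ω ωo p q p' q' : ℂ} {l : ℝ} (hα : α ≠ 0)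
    (hαβ : ‖α‖ ^ 2 + ‖β‖ ^ 2 = 1) (hω : ‖ω‖ = 1)
    (hl : l ^ 2 - 2 * ω.re * l + ‖α‖ ^ 2 = 0) (hp : p ≠ 0) (hq : β * q = (l - starRingEnd ℂ ω) * p)
    (h : TransferStep α β ωo p q p' q') :
    β * q' = (ω - l) * p' ↔
      (ω - l) * ωo + starRingEnd ℂ ((ω - l) * ωo) = -2 * (‖β‖ : ℂ) ^ 2 := by
  have hbb := mul_conj_eq_norm_sq β
  have hww := mul_conj_eq_one hω
  have hre : ω + starRingEnd ℂ ω = 2 * (ω.re : ℂ) := by rw [Complex.add_conj]; push_cast; ring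
  have hl' : (l : ℂ) ^ 2 - 2 * (ω.re : ℂ) * l + (‖α‖ : ℂ) ^ 2 = 0 := by exact_mod_cast hl
  have hab : (‖α‖ : ℂ) ^ 2 + (‖β‖ : ℂ) ^ 2 = 1 := by exact_mod_cast hαβ
  simp only [map_mul, map_sub, Complex.conj_ofReal]
  obtain ⟨h1, h2⟩ := h
  have key : α * (β * q' - (ω - l) * p') =
      -(p * ((ω - l) * ωo + (starRingEnd ℂ ω - l) * starRingEnd ℂ ωo
        - -2 * (‖β‖ : ℂ) ^ 2)) := by
    linear_combination β * h2 - (ω - l) * h1 + (starRingEnd ℂ ωo + (ω - l)) * hq - p * hbb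
      - p * hww + p * l * hre - p * hl' + p * hab
  constructor
  · intro h
    apply sub_eq_zero.1
    apply mul_left_cancel₀ hp
    linear_combination key - α * h
  · intro h
    apply sub_eq_zero.1
    apply mul_left_cancel₀ hα
    linear_combination key - p * h

theorem tendsto_zero_of_summable_norm_sq {p : ℤ → ℂ} (hp : Summable fun x => ‖p x‖ ^ 2)
    {f : ℕ → ℤ} (hf : Function.Injective f) :
    Filter.Tendsto (fun n => p (f n)) Filter.atTop (nhds 0) := by
  have h := (hp.comp_injective hf).tendsto_atTop_zero.sqrt
  rw [tendsto_zero_iff_norm_tendsto_zero]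
  simpa using h

/-- The solutions decaying at `+∞` and at `-∞` belong to the same root `l`, the smaller one, and the
defect joins them. -/
theorem matching_of_summable_solution {α β ω ωo : ℂ} {p q : ℤ → ℂ} (hα : α ≠ 0) (hβ : β ≠ 0)
    (hαβ : ‖α‖ ^ 2 + ‖β‖ ^ 2 = 1) (hω : ‖ω‖ = 1) (hωo : ‖ωo‖ = 1)
    (hp : Summable fun x => ‖p x‖ ^ 2) (hq : Summable fun x => ‖q x‖ ^ 2)
    (hne : ∃ x, ¬(p x = 0 ∧ q x = 0))
    (h : ∀ x, TransferStep α β (if x = 0 then ωo else ω) (p x) (q x) (p (x + 1)) (q (x + 1))) :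
    ∃ l : ℝ, |l| < ‖α‖ ∧ l ^ 2 - 2 * ω.re * l + ‖α‖ ^ 2 = 0 ∧
      (ω - l) * ωo + starRingEnd ℂ ((ω - l) * ωo) = -2 * (‖β‖ : ℂ) ^ 2 := by
  have hn : ∀ y, ¬(p y = 0 ∧ q y = 0) := by
    intro y hy
    obtain ⟨x, hx⟩ := hne
    exact hx (eq_zero_of_transferStep hα hαβ (fun x => by split_ifs <;> assumption) h hy x)
  have hinj : Function.Injective fun n : ℕ => (n : ℤ) + 1 := fun m n hmn => by simpa using hmn
  have hinj' : Function.Injective fun n : ℕ => -(n : ℤ) := fun m n hmn => by simpa using hmn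
  obtain ⟨l, hl, hroot, -, hdir⟩ := exists_real_eigenvalue_of_tendsto_zero hα hβ hαβ hω
    (p := fun n => p (n + 1)) (q := fun n => q (n + 1)) (fun n => by
      have := h (n + 1)
      rw [if_neg (by omega)] at this
      simpa using this)
    (tendsto_zero_of_summable_norm_sq hp hinj) (tendsto_zero_of_summable_norm_sq hq hinj)
    (hn _)
  obtain ⟨l', hl', hroot', hp0, hdir'⟩ := exists_real_eigenvalue_of_tendsto_zero
    (α := starRingEnd ℂ α) (β := -β) (ω := starRingEnd ℂ ω)
    (p := fun n => p (-n)) (q := fun n => q (-n)) ((map_ne_zero _).2 hα) (neg_ne_zero.2 hβ)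
    (by simpa using hαβ) (by simpa using hω) (fun n => by
      have := h (-((n : ℤ) + 1))
      rw [if_neg (by omega)] at this
      have := this.reverse hα hαβ hω
      rw [show -((n : ℤ) + 1) + 1 = -n by ring] at this
      simpa using this)
    (tendsto_zero_of_summable_norm_sq hp hinj') (tendsto_zero_of_summable_norm_sq hq hinj')
    (hn _)
  rw [RCLike.norm_conj] at hl' hroot'
  rw [Complex.conj_re] at hroot'
  obtain rfl := eq_of_root_of_abs_lt hroot' hroot hl' hl
  refine ⟨l', hl', hroot, ?_⟩
  have h0 := h 0
  rw [if_pos rfl] at h0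
  simp only [Nat.cast_zero, neg_zero, zero_add] at hdir hdir' hp0 h0
  exact (matching_iff hα hαβ hω hroot hp0 (by linear_combination -hdir') h0).1 hdir

theorem summable_norm_sq_geometric {k c : ℂ} (hk : ‖k‖ < 1) :
    Summable fun n : ℕ => ‖k ^ n * c‖ ^ 2 := by
  have : ∀ n : ℕ, ‖k ^ n * c‖ ^ 2 = (‖k‖ ^ 2) ^ n * ‖c‖ ^ 2 := fun n => by
    rw [norm_mul, norm_pow]; ring
  simp only [this]
  exact (summable_geometric_of_lt_one (by positivity)
    (pow_lt_one₀ (norm_nonneg _) hk two_ne_zero)).mul_right _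

/-- The sequence on `ℤ` that starts from `b` at `0` and is multiplied by `k` in each step to the
left, and starts from `a` at `1` and is multiplied by `m` in each step to the right. -/
noncomputable def twoSidedGeometric (k b m a : ℂ) (x : ℤ) : ℂ :=
  if x ≤ 0 then k ^ (-x).toNat * b else m ^ (x - 1).toNat * a

theorem twoSidedGeometric_neg (k b m a : ℂ) (n : ℕ) :
    twoSidedGeometric k b m a (-n) = k ^ n * b := by
  simp [twoSidedGeometric]

theorem twoSidedGeometric_zero (k b m a : ℂ) : twoSidedGeometric k b m a 0 = b := by
  simp [twoSidedGeometric]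

theorem twoSidedGeometric_add_one (k b m a : ℂ) (n : ℕ) :
    twoSidedGeometric k b m a (n + 1) = m ^ n * a := by
  rw [twoSidedGeometric, if_neg (by omega)]
  simp

theorem summable_norm_sq_twoSidedGeometric {k m : ℂ} (hk : ‖k‖ < 1) (hm : ‖m‖ < 1) (b a : ℂ) :
    Summable fun x => ‖twoSidedGeometric k b m a x‖ ^ 2 := by
  refine Summable.of_nat_of_neg ((summable_nat_add_iff 1).1 ?_) ?_
  · simpa only [Nat.cast_add, Nat.cast_one, twoSidedGeometric_add_one]
      using summable_norm_sq_geometric hm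
  · simpa only [twoSidedGeometric_neg] using summable_norm_sq_geometric hk

/-- The vector `(p, q)` is an eigenvector of `[ω, -β; -β̄, ω̄]` for a root `l` of its characteristic
polynomial, which makes `l / α` the factor of a step. -/
theorem transferStep_of_eigenvector {α β ω p q : ℂ} {l : ℝ} (hα : α ≠ 0) (hβ : β ≠ 0)
    (hαβ : ‖α‖ ^ 2 + ‖β‖ ^ 2 = 1) (hω : ‖ω‖ = 1)
    (hl : l ^ 2 - 2 * ω.re * l + ‖α‖ ^ 2 = 0) (hq : β * q = (ω - l) * p) :
    TransferStep α β ω p q (l / α * p) (l / α * q) := by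
  have hbb := mul_conj_eq_norm_sq β
  have hww := mul_conj_eq_one hω
  have hre : ω + starRingEnd ℂ ω = 2 * (ω.re : ℂ) := by rw [Complex.add_conj]; push_cast; ring
  have hl' : (l : ℂ) ^ 2 - 2 * (ω.re : ℂ) * l + (‖α‖ : ℂ) ^ 2 = 0 := by exact_mod_cast hl
  have hab : (‖α‖ : ℂ) ^ 2 + (‖β‖ : ℂ) ^ 2 = 1 := by exact_mod_cast hαβ
  have hk : α * (l / α) = l := mul_div_cancel₀ _ hα
  constructor
  · linear_combination p * hk + hq
  · apply mul_left_cancel₀ hβ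
    linear_combination β * q * hk + (l - starRingEnd ℂ ω) * hq + p * hbb - p * hl'
      + p * l * hre - p * hww + p * hab

theorem exists_summable_solution_of_matching {α β ω ωo : ℂ} {l : ℝ} (hα : α ≠ 0) (hβ : β ≠ 0)
    (hαβ : ‖α‖ ^ 2 + ‖β‖ ^ 2 = 1) (hω : ‖ω‖ = 1) (hla : |l| < ‖α‖)
    (hl : l ^ 2 - 2 * ω.re * l + ‖α‖ ^ 2 = 0)
    (hm : (ω - l) * ωo + starRingEnd ℂ ((ω - l) * ωo) = -2 * (‖β‖ : ℂ) ^ 2) :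
    ∃ p q : ℤ → ℂ, (Summable fun x => ‖p x‖ ^ 2) ∧ (Summable fun x => ‖q x‖ ^ 2) ∧
      (∃ x, ¬(p x = 0 ∧ q x = 0)) ∧
      ∀ x, TransferStep α β (if x = 0 then ωo else ω) (p x) (q x) (p (x + 1)) (q (x + 1)) := by
  set q₀ : ℂ := l - starRingEnd ℂ ω
  set p₁ : ℂ := (ωo * β - β * q₀) / α
  set q₁ : ℂ := (-(starRingEnd ℂ β) * β + starRingEnd ℂ ωo * q₀) / α
  have hstep : TransferStep α β ωo β q₀ p₁ q₁ := ⟨mul_div_cancel₀ _ hα, mul_div_cancel₀ _ hα⟩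
  have hdir : β * q₁ = (ω - l) * p₁ :=
    (matching_iff hα hαβ hω hl hβ (mul_comm _ _) hstep).2 hm
  have hαc : starRingEnd ℂ α ≠ 0 := (map_ne_zero _).2 hα
  have hR := transferStep_of_eigenvector hα hβ hαβ hω hl hdir
  have hL := (transferStep_of_eigenvector (α := starRingEnd ℂ α) (β := -β)
    (ω := starRingEnd ℂ ω) (p := β) (q := q₀) (l := l) hαc (neg_ne_zero.2 hβ)
    (by simpa using hαβ) (by simpa using hω) (by simpa using hl) (by ring)).reverse
    hαc (by simpa using hαβ) (by simpa using hω)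
  simp only [Complex.conj_conj, neg_neg] at hL
  have hk : ‖(l : ℂ) / α‖ < 1 := by
    rw [norm_div, Complex.norm_real]
    exact (div_lt_one (norm_pos_iff.2 hα)).2 hla
  have hk' : ‖(l : ℂ) / starRingEnd ℂ α‖ < 1 := by
    rw [norm_div, Complex.norm_real, RCLike.norm_conj]
    exact (div_lt_one (norm_pos_iff.2 hα)).2 hla
  set k : ℂ := l / α
  set k' : ℂ := l / starRingEnd ℂ α
  refine ⟨twoSidedGeometric k' β k p₁, twoSidedGeometric k' q₀ k q₁,
    summable_norm_sq_twoSidedGeometric hk' hk _ _,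
    summable_norm_sq_twoSidedGeometric hk' hk _ _,
    ⟨0, fun h => hβ ?_⟩, fun x => ?_⟩
  · rw [← h.1, twoSidedGeometric_zero]
  rcases lt_trichotomy x 0 with hx | rfl | hx
  · obtain ⟨n, rfl⟩ : ∃ n : ℕ, x = -((n + 1 : ℕ) : ℤ) := ⟨(-x - 1).toNat, by omega⟩
    rw [if_neg hx.ne, twoSidedGeometric_neg, twoSidedGeometric_neg,
      show -((n + 1 : ℕ) : ℤ) + 1 = -(n : ℤ) by push_cast; ring, twoSidedGeometric_neg,
      twoSidedGeometric_neg, pow_succ, mul_assoc, mul_assoc]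
    exact hL.smul _
  · have e := twoSidedGeometric_add_one k' β k p₁ 0
    have e' := twoSidedGeometric_add_one k' q₀ k q₁ 0
    simp only [Nat.cast_zero, pow_zero, one_mul] at e e'
    rw [if_pos rfl, twoSidedGeometric_zero, twoSidedGeometric_zero, e, e']
    exact hstep
  · obtain ⟨n, rfl⟩ : ∃ n : ℕ, x = (n : ℤ) + 1 := ⟨(x - 1).toNat, by omega⟩
    have e := twoSidedGeometric_add_one k' β k p₁ (n + 1)
    have e' := twoSidedGeometric_add_one k' q₀ k q₁ (n + 1)
    push_cast at e e'
    rw [if_neg hx.ne', twoSidedGeometric_add_one, twoSidedGeometric_add_one, e, e',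
      pow_succ, mul_assoc, mul_assoc]
    exact hR.smul _

/-! ### Solving the matching condition -/

/-- The numerator `|β|(|β| + i s|α|)e^{iΔ_o} - e^{iΔ}` of `defectEigenvalue`. -/
noncomputable def defectNumerator (α β : ℂ) (Δ Δo s : ℝ) : ℂ :=
  (‖β‖ : ℂ) * ((‖β‖ : ℂ) + Complex.I * (s : ℂ) * (‖α‖ : ℂ)) *
    Complex.exp (Complex.I * Δo) - Complex.exp (Complex.I * Δ)

theorem defectEigenvalue_eq (α β : ℂ) (Δ Δo s : ℝ) :
    defectEigenvalue α β Δ Δo s =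
      defectNumerator α β Δ Δo s / (‖defectNumerator α β Δ Δo s‖ : ℂ) := rfl

/-- A complex number of modulus `b` and real part `-b²`, where `a² + b² = 1`, is one of
`-b(b ± ia)`. -/
theorem exists_sign_of_add_conj {a b : ℝ} {V : ℂ} (hab : a ^ 2 + b ^ 2 = 1)
    (hV : V * starRingEnd ℂ V = (b : ℂ) ^ 2) (hre : V + starRingEnd ℂ V = -2 * (b : ℂ) ^ 2) :
    ∃ s : ℝ, (s = 1 ∨ s = -1) ∧ V = -(b * (b + Complex.I * s * a)) := by
  rw [Complex.add_conj] at hre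
  rw [Complex.mul_conj, Complex.normSq_apply] at hV
  have h1 : 2 * V.re = -2 * b ^ 2 := by exact_mod_cast hre
  have h2 : V.re * V.re + V.im * V.im = b ^ 2 := by exact_mod_cast hV
  have h3 : V.re = -b ^ 2 := by linarith
  rw [h3] at h2
  have h4 : (V.im + b * a) * (V.im - b * a) = 0 := by linear_combination h2 - b ^ 2 * hab
  rcases mul_eq_zero.1 h4 with h | h
  · refine ⟨1, Or.inl rfl, Complex.ext ?_ ?_⟩
    · simp [h3, pow_two]
    · simp; linarith
  · refine ⟨-1, Or.inr rfl, Complex.ext ?_ ?_⟩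
    · simp [h3, pow_two]
    · simp; linarith

/-- The matching condition fixes the real part of `V = (ω - l) ω_o`, whose modulus is `|β|`; hence
`V = -|β|(|β| + i s|α|)` for a sign `s`. Multiplying by `e^{iΔ_o}` turns this into the statement that
the numerator is the real multiple `-(a² / l) z` of `z`, where `a = |α|`. -/
theorem exists_matching_iff {α β z : ℂ} {Δ Δo : ℝ} (hα : α ≠ 0)
    (hαβ : ‖α‖ ^ 2 + ‖β‖ ^ 2 = 1) (hz : ‖z‖ = 1) {ω ωo : ℂ}
    (hω : ω = z * starRingEnd ℂ (Complex.exp (Complex.I * Δ)))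
    (hωo : ωo = z * starRingEnd ℂ (Complex.exp (Complex.I * Δo))) :
    (∃ l : ℝ, |l| < ‖α‖ ∧ l ^ 2 - 2 * ω.re * l + ‖α‖ ^ 2 = 0 ∧
      (ω - l) * ωo + starRingEnd ℂ ((ω - l) * ωo) = -2 * (‖β‖ : ℂ) ^ 2) ↔
    ∃ s : ℝ, (s = 1 ∨ s = -1) ∧ ∃ m : ℝ, ‖α‖ < |m| ∧ defectNumerator α β Δ Δo s = m * z := by
  have hα0 : 0 < ‖α‖ := norm_pos_iff.2 hα
  have hzz := mul_conj_eq_one hz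
  have hee := mul_conj_eq_one (norm_exp_I_mul Δ)
  have hoo := mul_conj_eq_one (norm_exp_I_mul Δo)
  have hww : ω * starRingEnd ℂ ω = 1 := by
    rw [hω, map_mul, Complex.conj_conj]
    linear_combination hzz + z * starRingEnd ℂ z * hee
  have hwo : ωo * starRingEnd ℂ ωo = 1 := by
    rw [hωo, map_mul, Complex.conj_conj]
    linear_combination hzz + z * starRingEnd ℂ z * hoo
  have he : Complex.exp (Complex.I * Δ) = z * starRingEnd ℂ ω := by
    rw [hω, map_mul, Complex.conj_conj]
    linear_combination -Complex.exp (Complex.I * Δ) * hzz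
  have hre : ω + starRingEnd ℂ ω = 2 * (ω.re : ℂ) := by rw [Complex.add_conj]; push_cast; ring
  have hab : (‖α‖ : ℂ) ^ 2 + (‖β‖ : ℂ) ^ 2 = 1 := by exact_mod_cast hαβ
  simp only [defectNumerator]
  rw [he]
  constructor
  · rintro ⟨l, hla, hl, hm⟩
    have hl' : (l : ℂ) ^ 2 - 2 * (ω.re : ℂ) * l + (‖α‖ : ℂ) ^ 2 = 0 := by exact_mod_cast hl
    have hV : ((ω - l) * ωo) * starRingEnd ℂ ((ω - l) * ωo) = (‖β‖ : ℂ) ^ 2 := by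
      simp only [map_mul, map_sub, Complex.conj_ofReal]
      linear_combination (ω - l) * (starRingEnd ℂ ω - l) * hwo + hww - l * hre + hl' - hab
    obtain ⟨s, hs, hVs⟩ := exists_sign_of_add_conj hαβ hV hm
    -- The second root of the characteristic polynomial is `a² / l`, of modulus larger than `a`.
    refine ⟨s, hs, l - 2 * ω.re, ?_, ?_⟩
    · have hprod : l * (l - 2 * ω.re) = -‖α‖ ^ 2 := by linear_combination hl
      have habs := congrArg abs hprod
      rw [abs_mul, abs_neg, abs_of_nonneg (by positivity : 0 ≤ ‖α‖ ^ 2)] at habs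
      by_contra! hle
      nlinarith [abs_nonneg l]
    · push_cast
      rw [← hre]
      rw [hωo] at hVs
      linear_combination Complex.exp (Complex.I * Δo) * hVs - (ω - l) * z * hoo
  · rintro ⟨s, hs, m, hm, hW⟩
    have hss : (s : ℂ) ^ 2 = 1 := by rcases hs with rfl | rfl <;> simp
    -- With `V = -b(b + isa)`, the equation says `V = (-m - ω̄) ω_o`.
    have hV : -((‖β‖ : ℂ) * (‖β‖ + Complex.I * s * ‖α‖)) = (-m - starRingEnd ℂ ω) * ωo := by
      rw [hωo]
      linear_combination -starRingEnd ℂ (Complex.exp (Complex.I * Δo)) * hW +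
        (‖β‖ : ℂ) * (‖β‖ + Complex.I * s * ‖α‖) * hoo
    have hVc := congrArg (starRingEnd ℂ) hV
    simp only [map_mul, map_sub, map_neg, map_add, Complex.conj_ofReal, Complex.conj_I,
      Complex.conj_conj] at hVc
    have hchar' : (m : ℂ) ^ 2 + 2 * (ω.re : ℂ) * m + (‖α‖ : ℂ) ^ 2 = 0 := by
      have h1 : (‖β‖ : ℂ) ^ 2 * ((‖β‖ : ℂ) ^ 2 + (‖α‖ : ℂ) ^ 2) =
          (-m - starRingEnd ℂ ω) * (-m - ω) := by
        have h2 := congrArg₂ (· * ·) hV hVc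
        linear_combination h2 + (-m - starRingEnd ℂ ω) * (-m - ω) * hwo
          + (‖β‖ : ℂ) ^ 2 * (‖α‖ : ℂ) ^ 2 * ((s : ℂ) ^ 2 * Complex.I_sq - hss)
      linear_combination -h1 - hww - m * hre + ((‖β‖ : ℂ) ^ 2 + 1) * hab
    have hchar : m ^ 2 + 2 * ω.re * m + ‖α‖ ^ 2 = 0 := by exact_mod_cast hchar'
    refine ⟨2 * ω.re + m, ?_, by linear_combination hchar, ?_⟩
    · have hprod : (2 * ω.re + m) * m = -‖α‖ ^ 2 := by linear_combination hchar
      have habs := congrArg abs hprod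
      rw [abs_mul, abs_neg, abs_of_nonneg (by positivity : 0 ≤ ‖α‖ ^ 2)] at habs
      by_contra! hle
      nlinarith [abs_nonneg m]
    · have hd : ω - ((2 * ω.re + m : ℝ) : ℂ) = -m - starRingEnd ℂ ω := by
        push_cast
        linear_combination hre
      rw [hd, map_mul, map_sub, map_neg, Complex.conj_ofReal, Complex.conj_conj, ← hV, ← hVc]
      ring

theorem mem_pointSpectrum_iff {α β : ℂ} {Δ Δo : ℝ} (hα : α ≠ 0) (hβ : β ≠ 0)
    (hαβ : ‖α‖ ^ 2 + ‖β‖ ^ 2 = 1) (z : ℂ) :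
    z ∈ pointSpectrum (evolution
      (twoPhaseOneDefect ⟨α, β, Δ, hα, hαβ⟩ ⟨α, β, Δo, hα, hαβ⟩ ⟨α, β, Δ, hα, hαβ⟩)) ↔
    ‖z‖ = 1 ∧ ∃ s : ℝ, (s = 1 ∨ s = -1) ∧
      ∃ m : ℝ, ‖α‖ < |m| ∧ defectNumerator α β Δ Δo s = m * z := by
  rw [mem_pointSpectrum_evolution_iff]
  refine and_congr_right fun hz => ?_
  have hc : ∀ x, TransferStep
      (twoPhaseOneDefect ⟨α, β, Δ, hα, hαβ⟩ ⟨α, β, Δo, hα, hαβ⟩ ⟨α, β, Δ, hα, hαβ⟩ x).α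
      (twoPhaseOneDefect ⟨α, β, Δ, hα, hαβ⟩ ⟨α, β, Δo, hα, hαβ⟩ ⟨α, β, Δ, hα, hαβ⟩ x).β
      (z * starRingEnd ℂ (Complex.exp (Complex.I * (twoPhaseOneDefect
        ⟨α, β, Δ, hα, hαβ⟩ ⟨α, β, Δo, hα, hαβ⟩ ⟨α, β, Δ, hα, hαβ⟩ x).Δ))) =
      TransferStep α β (if x = 0 then z * starRingEnd ℂ (Complex.exp (Complex.I * Δo))
        else z * starRingEnd ℂ (Complex.exp (Complex.I * Δ))) := by
    intro x
    rcases lt_trichotomy x 0 with hx | rfl | hx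
    · simp [twoPhaseOneDefect, hx, hx.ne]
    · simp [twoPhaseOneDefect]
    · simp [twoPhaseOneDefect, hx.not_gt, hx.ne']
  simp only [hc]
  have hnorm : ∀ t : ℝ, ‖z * starRingEnd ℂ (Complex.exp (Complex.I * t))‖ = 1 := fun t => by
    rw [norm_mul, RCLike.norm_conj, norm_exp_I_mul, hz, one_mul]
  rw [← exists_matching_iff hα hαβ hz rfl rfl]
  constructor
  · rintro ⟨p, q, hp, hq, hne, h⟩
    exact matching_of_summable_solution hα hβ hαβ (hnorm Δ) (hnorm Δo) hp hq hne h
  · rintro ⟨l, hla, hl, hm⟩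
    exact exists_summable_solution_of_matching hα hβ hαβ (hnorm Δ) hla hl hm

/-! ### The two conditions and the distinctness of the eigenvalues -/

theorem defectNumerator_re (α β : ℂ) (Δ Δo s : ℝ) : (defectNumerator α β Δ Δo s).re =
    ‖β‖ * (‖β‖ * Real.cos Δo - s * ‖α‖ * Real.sin Δo) - Real.cos Δ := by
  have h : ∀ t : ℝ, Complex.exp (Complex.I * t) = Real.cos t + Real.sin t * Complex.I :=
    fun t => by rw [mul_comm, Complex.exp_mul_I]; simp
  simp only [defectNumerator, h, Complex.sub_re, Complex.mul_re, Complex.add_re, Complex.mul_im,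
    Complex.add_im, Complex.ofReal_re, Complex.ofReal_im, Complex.I_re, Complex.I_im]
  ring

theorem defectNumerator_im (α β : ℂ) (Δ Δo s : ℝ) : (defectNumerator α β Δ Δo s).im =
    ‖β‖ * (‖β‖ * Real.sin Δo + s * ‖α‖ * Real.cos Δo) - Real.sin Δ := by
  have h : ∀ t : ℝ, Complex.exp (Complex.I * t) = Real.cos t + Real.sin t * Complex.I :=
    fun t => by rw [mul_comm, Complex.exp_mul_I]; simp
  simp only [defectNumerator, h, Complex.sub_im, Complex.mul_re, Complex.add_re, Complex.mul_im,
    Complex.add_im, Complex.ofReal_re, Complex.ofReal_im, Complex.I_re, Complex.I_im]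
  ring

theorem norm_sq_defectNumerator {α β : ℂ} (hαβ : ‖α‖ ^ 2 + ‖β‖ ^ 2 = 1) (Δ Δo : ℝ) {s : ℝ}
    (hs : s ^ 2 = 1) : ‖defectNumerator α β Δ Δo s‖ ^ 2 = ‖α‖ ^ 2 +
      2 * ‖β‖ * (‖β‖ - (‖β‖ * Real.cos (Δo - Δ) - s * ‖α‖ * Real.sin (Δo - Δ))) := by
  rw [← Complex.normSq_eq_norm_sq, Complex.normSq_apply, defectNumerator_re, defectNumerator_im,
    Real.cos_sub, Real.sin_sub]
  linear_combination ‖β‖ ^ 2 * (‖β‖ ^ 2 + s ^ 2 * ‖α‖ ^ 2) * Real.sin_sq_add_cos_sq Δo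
    + Real.sin_sq_add_cos_sq Δ + ‖β‖ ^ 2 * ‖α‖ ^ 2 * hs + (‖β‖ ^ 2 - 1) * hαβ

/-- For `s = 1` and `s = -1` the right-hand side is the first and the second condition. It says that
`|α| / |w|`, the factor by which eigenvectors are multiplied per site away from the defect, is less
than one, where `w` is the numerator. -/
theorem norm_lt_norm_defectNumerator_iff {α β : ℂ} (hβ : β ≠ 0) (hαβ : ‖α‖ ^ 2 + ‖β‖ ^ 2 = 1)
    (Δ Δo : ℝ) {s : ℝ} (hs : s ^ 2 = 1) : ‖α‖ < ‖defectNumerator α β Δ Δo s‖ ↔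
      ‖β‖ * Real.cos (Δo - Δ) - s * ‖α‖ * Real.sin (Δo - Δ) < ‖β‖ := by
  have hβ0 : 0 < ‖β‖ := norm_pos_iff.2 hβ
  rw [← pow_lt_pow_iff_left₀ (norm_nonneg _) (norm_nonneg _) two_ne_zero,
    norm_sq_defectNumerator hαβ Δ Δo hs, lt_add_iff_pos_right,
    mul_pos_iff_of_pos_left (by positivity), sub_pos]

theorem condition1_iff {α β : ℂ} (hβ : β ≠ 0) (hαβ : ‖α‖ ^ 2 + ‖β‖ ^ 2 = 1) (Δ Δo : ℝ) :
    Condition1 α β Δ Δo ↔ ‖α‖ < ‖defectNumerator α β Δ Δo 1‖ := by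
  rw [norm_lt_norm_defectNumerator_iff hβ hαβ Δ Δo (by norm_num), one_mul, Condition1]

theorem condition2_iff {α β : ℂ} (hβ : β ≠ 0) (hαβ : ‖α‖ ^ 2 + ‖β‖ ^ 2 = 1) (Δ Δo : ℝ) :
    Condition2 α β Δ Δo ↔ ‖α‖ < ‖defectNumerator α β Δ Δo (-1)‖ := by
  rw [norm_lt_norm_defectNumerator_iff hβ hαβ Δ Δo (by norm_num), Condition2, neg_one_mul, neg_mul,
    sub_neg_eq_add]

/-- For `w ≠ 0`, the unit vectors on the real line through `w` are `± w / |w|`. -/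
theorem norm_one_and_exists_real_mul_iff {a : ℝ} (ha : 0 < a) (w z : ℂ) :
    (‖z‖ = 1 ∧ ∃ m : ℝ, a < |m| ∧ w = m * z) ↔
      a < ‖w‖ ∧ (z = w / (‖w‖ : ℂ) ∨ z = -(w / (‖w‖ : ℂ))) := by
  constructor
  · rintro ⟨hz, m, hm, rfl⟩
    have hn : ‖(m : ℂ) * z‖ = |m| := by rw [norm_mul, hz, mul_one, Complex.norm_real]; rfl
    rw [hn]
    refine ⟨hm, ?_⟩
    have hm0 : (m : ℂ) ≠ 0 := by
      rw [Complex.ofReal_ne_zero, ← abs_pos]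
      exact ha.trans hm
    rcases abs_choice m with h | h <;> rw [h]
    · left
      field_simp
    · right
      push_cast
      field_simp
  · rintro ⟨hw, hz⟩
    have hw0 : (‖w‖ : ℂ) ≠ 0 := Complex.ofReal_ne_zero.2 (ha.trans hw).ne'
    have hn : ‖w / (‖w‖ : ℂ)‖ = 1 := by
      rw [norm_div, Complex.norm_real, norm_norm, div_self (ha.trans hw).ne']
    rcases hz with rfl | rfl
    · exact ⟨hn, ‖w‖, by rwa [abs_norm], by field_simp⟩
    · refine ⟨by rwa [norm_neg], -‖w‖, by rwa [abs_neg, abs_norm], ?_⟩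
      push_cast
      field_simp

/-- The point spectrum: for each sign, the two normalised values `± w / |w|` of the numerator `w`,
provided the corresponding condition holds. -/
theorem mem_pointSpectrum_iff_condition {α β : ℂ} {Δ Δo : ℝ} (hα : α ≠ 0) (hβ : β ≠ 0)
    (hαβ : ‖α‖ ^ 2 + ‖β‖ ^ 2 = 1) (z : ℂ) :
    z ∈ pointSpectrum (evolution
      (twoPhaseOneDefect ⟨α, β, Δ, hα, hαβ⟩ ⟨α, β, Δo, hα, hαβ⟩ ⟨α, β, Δ, hα, hαβ⟩)) ↔
    (Condition1 α β Δ Δo ∧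
      (z = defectEigenvalue α β Δ Δo 1 ∨ z = -defectEigenvalue α β Δ Δo 1)) ∨
    (Condition2 α β Δ Δo ∧
      (z = defectEigenvalue α β Δ Δo (-1) ∨ z = -defectEigenvalue α β Δ Δo (-1))) := by
  have hα0 : 0 < ‖α‖ := norm_pos_iff.2 hα
  rw [mem_pointSpectrum_iff hα hβ hαβ, condition1_iff hβ hαβ, condition2_iff hβ hαβ,
    defectEigenvalue_eq, defectEigenvalue_eq, ← norm_one_and_exists_real_mul_iff hα0,
    ← norm_one_and_exists_real_mul_iff hα0, ← and_or_left]
  refine and_congr_right fun _ => ?_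
  simp only [or_and_right, exists_or, exists_eq_left]

/-- Under both conditions the two numerators are not real multiples of each other: this could only
happen for `cos(Δ_o - Δ) = |β|²`, where the conditions fail. -/
theorem defectNumerator_cross_ne_zero {α β : ℂ} {Δ Δo : ℝ} (hα : α ≠ 0) (hβ : β ≠ 0)
    (hαβ : ‖α‖ ^ 2 + ‖β‖ ^ 2 = 1) (h1 : Condition1 α β Δ Δo) (h2 : Condition2 α β Δ Δo) :
    (defectNumerator α β Δ Δo 1).im * (defectNumerator α β Δ Δo (-1)).re -
      (defectNumerator α β Δ Δo 1).re * (defectNumerator α β Δ Δo (-1)).im ≠ 0 := by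
  have hα0 : 0 < ‖α‖ := norm_pos_iff.2 hα
  have hβ0 : 0 < ‖β‖ := norm_pos_iff.2 hβ
  intro h
  have hcos : Real.cos (Δo - Δ) = ‖β‖ ^ 2 := by
    apply mul_left_cancel₀ (by positivity : 2 * ‖α‖ * ‖β‖ ≠ 0)
    rw [defectNumerator_re, defectNumerator_im, defectNumerator_re, defectNumerator_im] at h
    rw [Real.cos_sub]
    linear_combination -h + 2 * ‖α‖ * ‖β‖ * ‖β‖ ^ 2 * Real.sin_sq_add_cos_sq Δo
  unfold Condition1 at h1
  unfold Condition2 at h2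
  have hsc := Real.sin_sq_add_cos_sq (Δo - Δ)
  rw [hcos] at h1 h2 hsc
  have hpos := mul_pos (sub_pos.2 h1) (sub_pos.2 h2)
  have hval : (‖β‖ - (‖β‖ * ‖β‖ ^ 2 - ‖α‖ * Real.sin (Δo - Δ))) *
      (‖β‖ - (‖β‖ * ‖β‖ ^ 2 + ‖α‖ * Real.sin (Δo - Δ))) = -(‖α‖ ^ 2) ^ 2 := by
    have hα2 : ‖α‖ ^ 2 = 1 - ‖β‖ ^ 2 := by linarith
    have hsin : Real.sin (Δo - Δ) ^ 2 = 1 - (‖β‖ ^ 2) ^ 2 := by linarith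
    calc _ = ‖β‖ ^ 2 * (1 - ‖β‖ ^ 2) ^ 2 - ‖α‖ ^ 2 * Real.sin (Δo - Δ) ^ 2 := by ring
      _ = _ := by rw [hsin, hα2]; ring
  rw [hval] at hpos
  have : 0 < (‖α‖ ^ 2) ^ 2 := by positivity
  linarith

theorem cross_eq_zero_of_eq_real_mul {w w' z : ℂ} {m m' : ℝ} (h : w = m * z) (h' : w' = m' * z) :
    w.im * w'.re - w.re * w'.im = 0 := by
  subst h h'
  simp only [Complex.mul_re, Complex.mul_im, Complex.ofReal_re, Complex.ofReal_im]
  ring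

theorem ncard_pair_and_neg {a b : ℂ} (ha : a ≠ 0) (hb : b ≠ 0) (h : a ≠ b) (h' : a ≠ -b) :
    ({a, -a, b, -b} : Set ℂ).ncard = 4 := by
  have e : ({a, -a, b, -b} : Set ℂ) = (({a, -a, b, -b} : Finset ℂ) : Set ℂ) := by simp
  have h'' : -a ≠ b := fun hh => h' (by rw [← hh, neg_neg])
  rw [e, Set.ncard_coe_finset, Finset.card_insert_of_notMem, Finset.card_insert_of_notMem,
    Finset.card_pair (self_ne_neg.2 hb)]
  · simp [h'', h]
  · simp [h, h', self_ne_neg.2 ha]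

theorem mainTheorem3 (α β : ℂ) (Δ Δo : ℝ) (hα : α ≠ 0) (hβ : β ≠ 0)
    (hαβ : ‖α‖ ^ 2 + ‖β‖ ^ 2 = 1)
    (U : QWState →ₗ[ℂ] QWState)
    (hU : U = evolution
      (twoPhaseOneDefect ⟨α, β, Δ, hα, hαβ⟩ ⟨α, β, Δo, hα, hαβ⟩ ⟨α, β, Δ, hα, hαβ⟩))
    (z₁ z₂ z₃ z₄ : ℂ)
    (hz₁ : z₁ = defectEigenvalue α β Δ Δo 1) (hz₂ : z₂ = -z₁)
    (hz₃ : z₃ = defectEigenvalue α β Δ Δo (-1)) (hz₄ : z₄ = -z₃) :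
    ((pointSpectrum U).Nonempty ↔ Condition1 α β Δ Δo ∨ Condition2 α β Δ Δo) ∧
    (Condition1 α β Δ Δo → z₁ ∈ pointSpectrum U ∧ z₂ ∈ pointSpectrum U) ∧
    (Condition2 α β Δ Δo → z₃ ∈ pointSpectrum U ∧ z₄ ∈ pointSpectrum U) ∧
    (∀ z ∈ pointSpectrum U,
      (Condition1 α β Δ Δo ∧ (z = z₁ ∨ z = z₂)) ∨ (Condition2 α β Δ Δo ∧ (z = z₃ ∨ z = z₄))) ∧
    (Condition1 α β Δ Δo ∧ Condition2 α β Δ Δo →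
      pointSpectrum U = {z₁, z₂, z₃, z₄} ∧ (pointSpectrum U).ncard = 4) := by
  have key : ∀ z, z ∈ pointSpectrum U ↔
      (Condition1 α β Δ Δo ∧ (z = z₁ ∨ z = z₂)) ∨
        (Condition2 α β Δ Δo ∧ (z = z₃ ∨ z = z₄)) := by
    subst hU hz₂ hz₄ hz₁ hz₃
    exact mem_pointSpectrum_iff_condition hα hβ hαβ
  have hfst : Condition1 α β Δ Δo → z₁ ∈ pointSpectrum U ∧ z₂ ∈ pointSpectrum U := fun h =>
    ⟨(key _).2 (Or.inl ⟨h, Or.inl rfl⟩), (key _).2 (Or.inl ⟨h, Or.inr rfl⟩)⟩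
  have hsnd : Condition2 α β Δ Δo → z₃ ∈ pointSpectrum U ∧ z₄ ∈ pointSpectrum U := fun h =>
    ⟨(key _).2 (Or.inr ⟨h, Or.inl rfl⟩), (key _).2 (Or.inr ⟨h, Or.inr rfl⟩)⟩
  refine ⟨⟨?_, ?_⟩, hfst, hsnd, fun z => (key z).1, ?_⟩
  · rintro ⟨z, hz⟩
    exact ((key z).1 hz).imp And.left And.left
  · rintro (h | h)
    exacts [⟨z₁, (hfst h).1⟩, ⟨z₃, (hsnd h).1⟩]
  · rintro ⟨h1, h2⟩
    have hset : pointSpectrum U = {z₁, z₂, z₃, z₄} := by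
      ext z
      simp only [key z, h1, h2, true_and, Set.mem_insert_iff, Set.mem_singleton_iff, or_assoc]
    refine ⟨hset, ?_⟩
    have hα0 : 0 < ‖α‖ := norm_pos_iff.2 hα
    obtain ⟨hn1, m1, -, hm1⟩ := (norm_one_and_exists_real_mul_iff hα0
      (defectNumerator α β Δ Δo 1) z₁).2 ⟨(condition1_iff hβ hαβ Δ Δo).1 h1, Or.inl hz₁⟩
    obtain ⟨hn3, m3, -, hm3⟩ := (norm_one_and_exists_real_mul_iff hα0
      (defectNumerator α β Δ Δo (-1)) z₃).2 ⟨(condition2_iff hβ hαβ Δ Δo).1 h2, Or.inl hz₃⟩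
    have hcross := defectNumerator_cross_ne_zero hα hβ hαβ h1 h2
    rw [hset, hz₂, hz₄]
    refine ncard_pair_and_neg (norm_ne_zero_iff.1 (by rw [hn1]; exact one_ne_zero))
      (norm_ne_zero_iff.1 (by rw [hn3]; exact one_ne_zero)) (fun h => ?_) (fun h => ?_)
    · exact hcross (cross_eq_zero_of_eq_real_mul hm1 (h ▸ hm3))
    · refine hcross (cross_eq_zero_of_eq_real_mul hm1 (m' := -m3) ?_)
      rw [hm3, h]
      push_cast
      ring
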